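/- Let $\mathbb{Z}[t,t^{-1}]$ be the ring of Laurent polynomials in one variable with integer coefficients, and let $SL_2(\mathbb{Z}[t,t^{-1}])$ be the group of $2\times 2$ matrices of determinant $1$ over it. The group $SL_2(\mathbb{Z}[t,t^{-1}])$ is not finitely presented, i.e. it is not isomorphic to $\langle X \mid R\rangle$ for any finite set of generators $X$ and finite set of relators $R$. -/

import Mathlib

/-!
The group `Γ = SL₂(R[T;T⁻¹])`, with `R` an integral domain, acts on the product of the Bruhat–Tits
trees of the orders at `T = 0` and `T = ∞`. This is a contractible complex of dimension two, so a loop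
in it has a unique filling by squares. If `Γ` were finitely presented, loops coming from relations
between fixed generators could be filled within a bounded distance of an orbit. However, the relation
saying that the unipotent matrices with entries `1` and `T ^ (2 * k)` commute, with the second one
written as a conjugate of the first by the `k`-th power of the diagonal matrix `diag(T, T⁻¹)`, gives a
loop whose filling goes a distance of order `k` into a cusp.

The proof below uses neither trees nor fillings. The coefficient of a square in the filling of a loop
is a winding number, a discrete line integral `∫ α dβ` where `α` and `β` are the indicator functions
of the half-trees bounded by the two edges spanning the square (`InHalfTree`). Accumulating this
integral yields permutations `areaPerm α β a` of `Γ × ℤ`. For a sequence of squares moving into the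
cusp, any two given elements of `Γ` eventually satisfy
`areaPerm α β (a * b) = areaPerm α β a * areaPerm α β b` (`eventually_areaAction_mul`): by
`inHalfTree_mul_iff` and the inequality `ord₀ f + ord_∞ f ≤ 0` for nonzero `f`, no point of the orbit is
close to both edges. For a finitely presented group such asymptotically multiplicative maps are
eventually equal to homomorphisms (`Group.IsFinitelyPresented.exists_monoidHom_eventually_eq`), and
homomorphisms respect the commutation relation above. But the winding number of its loop around the
`k`-th square is not zero (`areaAction_not_commute`).
-/

open Matrix Filter
open scoped MatrixGroups LaurentPolynomial

noncomputable section

/-! ### Asymptotic homomorphisms from finitely presented groups -/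

/-- Maps from a finitely presented group which are asymptotically multiplicative along a filter agree,
at each element and eventually, with genuine homomorphisms: on the free group one takes the
homomorphisms with the same values on the generators, and each of the finitely many relators
eventually dies. -/
theorem Group.IsFinitelyPresented.exists_monoidHom_eventually_eq {G ι : Type*} [Group G]
    [hG : Group.IsFinitelyPresented G] {Q : ι → Type*} [∀ k, Group (Q k)] {l : Filter ι}
    (τ : ∀ k, G → Q k) (hτ : ∀ a b, ∀ᶠ k in l, τ k (a * b) = τ k a * τ k b) :
    ∃ θ : ∀ k, G →* Q k, ∀ a, ∀ᶠ k in l, θ k a = τ k a := by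
  classical
  obtain ⟨n, φ, hφ, S, hS, hSker⟩ := hG.out
  have hτ_one : ∀ᶠ k in l, τ k 1 = 1 := by
    filter_upwards [hτ 1 1] with k hk
    simpa using hk
  let ψ : ∀ k, FreeGroup (Fin n) →* Q k := fun k ↦ FreeGroup.lift fun i ↦ τ k (φ (.of i))
  have hψ : ∀ w, ∀ᶠ k in l, ψ k w = τ k (φ w) := by
    intro w
    induction w using FreeGroup.induction_on with
    | C1 => filter_upwards [hτ_one] with k hk; simp [hk]
    | of i => exact Eventually.of_forall fun k ↦ by simp [ψ]
    | inv_of i ih =>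
      filter_upwards [ih, hτ_one, hτ (φ (.of i)⁻¹) (φ (.of i))] with k h₁ h₂ h₃
      rw [map_inv, h₁, inv_eq_iff_mul_eq_one, eq_comm, ← h₂, ← mul_left_inj (τ k (φ (.of i)))]
      rw [← map_mul, inv_mul_cancel, map_one] at h₃
      rw [mul_assoc, ← h₃, h₂, one_mul, mul_one]
    | mul x y hx hy =>
      filter_upwards [hx, hy, hτ (φ x) (φ y)] with k h₁ h₂ h₃
      rw [map_mul, map_mul, h₁, h₂, h₃]
  have hker : ∀ᶠ k in l, φ.ker ≤ (ψ k).ker := by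
    have hrel : ∀ᶠ k in l, ∀ r ∈ S, ψ k r = 1 := by
      rw [hS.eventually_all]
      intro r hr
      have hr' : φ r = 1 := by
        rw [← MonoidHom.mem_ker, ← hSker]
        exact Subgroup.subset_normalClosure hr
      filter_upwards [hψ r, hτ_one] with k h₁ h₂
      rw [h₁, hr', h₂]
    filter_upwards [hrel] with k hk
    rw [← hSker]
    exact Subgroup.normalClosure_le_normal hk
  refine ⟨fun k ↦ if h : φ.ker ≤ (ψ k).ker then φ.liftOfSurjective hφ ⟨ψ k, h⟩ else 1, fun a ↦ ?_⟩
  obtain ⟨w, rfl⟩ := hφ a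
  filter_upwards [hψ w, hker] with k h₁ h₂
  rw [dif_pos h₂, ← h₁]
  exact φ.liftOfRightInverse_comp_apply _ _ ⟨ψ k, h₂⟩ w

/-! ### Orders of Laurent polynomials at zero and infinity -/

namespace LaurentPolynomial

variable {R : Type*} [CommRing R] [IsDomain R]

variable (R) in
/-- The order of vanishing at `T = 0`, i.e. the least exponent occurring in a Laurent polynomial,
with value `⊤` at `0`. -/
def orderAtZero : AddValuation R[T;T⁻¹] (WithTop ℤ) :=
  AddValuation.of (fun f ↦ f.coeff.support.min) (by simp)
    (by
      have h : (1 : R[T;T⁻¹]) = C 1 * T 0 := by simp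
      change (1 : R[T;T⁻¹]).coeff.support.min = 0
      rw [h, support_coeff_C_mul_T_of_ne_zero one_ne_zero, Finset.min_singleton]; rfl)
    (fun f g ↦ by
      simpa [Finset.min_eq_inf_withTop] using
        AddMonoidAlgebra.le_inf_support_coeff_add (R := R) (fun a : ℤ ↦ (a : WithTop ℤ)) f g)
    (fun f g ↦ by
      rcases eq_or_ne f 0 with rfl | hf
      · simp
      rcases eq_or_ne g 0 with rfl | hg
      · simp
      have hf' : f.coeff.support.Nonempty := by simpa [Finset.nonempty_iff_ne_empty] using hf
      have hg' : g.coeff.support.Nonempty := by simpa [Finset.nonempty_iff_ne_empty] using hg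
      apply le_antisymm
      · rw [← Finset.coe_min' hf', ← Finset.coe_min' hg', ← WithTop.coe_add]
        refine Finset.min_le ?_
        have hu : UniqueAdd f.coeff.support g.coeff.support (f.coeff.support.min' hf')
            (g.coeff.support.min' hg') := by
          intro a b ha hb hab
          have h₁ := Finset.min'_le _ a ha
          have h₂ := Finset.min'_le _ b hb
          omega
        rw [Finsupp.mem_support_iff, AddMonoidAlgebra.coeff_mul_add_of_uniqueAdd hu]
        exact mul_ne_zero (Finsupp.mem_support_iff.1 (Finset.min'_mem _ _))
          (Finsupp.mem_support_iff.1 (Finset.min'_mem _ _))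
      · simpa [Finset.min_eq_inf_withTop] using
          AddMonoidAlgebra.le_inf_support_coeff_mul (R := R)
            (degt := fun a : ℤ ↦ (a : WithTop ℤ)) (fun a b ↦ by simp) f g)

variable (R) in
/-- The order of vanishing at `T = ∞`, i.e. minus the degree, with value `⊤` at `0`. -/
def orderAtInfty : AddValuation R[T;T⁻¹] (WithTop ℤ) :=
  (orderAtZero R).comap (invert (R := R) : R[T;T⁻¹] →+* R[T;T⁻¹])

theorem orderAtZero_apply (f : R[T;T⁻¹]) : orderAtZero R f = f.coeff.support.min := rfl

theorem orderAtInfty_apply (f : R[T;T⁻¹]) : orderAtInfty R f = orderAtZero R (invert f) := rfl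

theorem orderAtZero_T (n : ℤ) : orderAtZero R (T n) = n := by
  rw [orderAtZero_apply, ← one_mul (T n), ← map_one C,
    support_coeff_C_mul_T_of_ne_zero one_ne_zero, Finset.min_singleton]

theorem orderAtInfty_T (n : ℤ) : orderAtInfty R (T n) = (-n : ℤ) := by
  rw [orderAtInfty_apply, invert_T, orderAtZero_T]

/-- The inequality left over from the product formula: the zeros away from `0` and `∞` only make the
sum of the two orders smaller. -/
theorem exists_orders_eq_of_ne_zero {f : R[T;T⁻¹]} (hf : f ≠ 0) :
    ∃ a b : ℤ, orderAtZero R f = a ∧ orderAtInfty R f = b ∧ a + b ≤ 0 := by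
  have hf' : invert f ≠ 0 := by simpa using hf
  have hfin : ∀ g : R[T;T⁻¹], g ≠ 0 → orderAtZero R g ≠ ⊤ := fun g hg ↦ by
    simpa [orderAtZero_apply, Finset.min_eq_top] using hg
  obtain ⟨a, ha⟩ := WithTop.ne_top_iff_exists.1 (hfin f hf)
  obtain ⟨b, hb⟩ := WithTop.ne_top_iff_exists.1 (hfin _ hf')
  refine ⟨a, b, ha.symm, hb.symm, ?_⟩
  have := Finset.mem_of_min ha.symm
  have h : (-a) ∈ (invert f).coeff.support := by
    rw [Finsupp.mem_support_iff] at this ⊢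
    simpa using this
  have := Finset.min_le h
  rw [← orderAtZero_apply, ← hb, WithTop.coe_le_coe] at this
  omega

end LaurentPolynomial

/-! ### Permutations accumulating a line integral -/

section LineIntegral

variable {G : Type*} [Group G]

/-- Left multiplication by `a` on the first coordinate, while the second one accumulates the increment
of the discrete line integral `∫ α dβ`. For indicator functions `α` and `β`, going around a closed
path adds its winding number around the corner at which both `α` and `β` jump. -/
def areaPerm (α β : G → ℤ) (a : G) : Equiv.Perm (G × ℤ) where
  toFun x := (a * x.1, x.2 + α x.1 * (β (a * x.1) - β x.1))
  invFun x := (a⁻¹ * x.1, x.2 - α (a⁻¹ * x.1) * (β x.1 - β (a⁻¹ * x.1)))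
  left_inv x := by simp
  right_inv x := by simp

theorem areaPerm_apply (α β : G → ℤ) (a : G) (x : G × ℤ) :
    areaPerm α β a x = (a * x.1, x.2 + α x.1 * (β (a * x.1) - β x.1)) := rfl

/-- The permutations `areaPerm α β` multiply as group elements do when no triangle of the form
`g`, `b * g`, `a * b * g` has `α` jumping on its first side and `β` on its second. -/
theorem areaPerm_mul {α β : G → ℤ} {a b : G}
    (h : ∀ g, α (b * g) = α g ∨ β (a * (b * g)) = β (b * g)) :
    areaPerm α β (a * b) = areaPerm α β a * areaPerm α β b := by
  ext1 x
  simp only [Equiv.Perm.mul_apply, areaPerm_apply, mul_assoc, Prod.mk.injEq, true_and]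
  rcases h x.1 with h | h <;> rw [h] <;> ring

theorem areaPerm_pow_apply (α β : G → ℤ) (a : G) (k : ℕ) (x : G × ℤ) :
    (areaPerm α β a ^ k) x =
      (a ^ k * x.1, x.2 + ∑ i ∈ Finset.range k,
        α (a ^ i * x.1) * (β (a ^ (i + 1) * x.1) - β (a ^ i * x.1))) := by
  induction k with
  | zero => simp
  | succ k ih =>
    rw [pow_succ', Equiv.Perm.mul_apply, ih, areaPerm_apply, Finset.sum_range_succ]
    simp [pow_succ', mul_assoc, add_assoc]

end LineIntegral

namespace Matrix.SpecialLinearGroup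

/-! ### Half-trees of a valuation -/

section HalfTree

variable {A : Type*} [CommRing A] (v : AddValuation A (WithTop ℤ))

/-- The least valuation of an entry of the second column of `g` exceeds that of the first column by
at least `n`. In the Bruhat–Tits tree of `v`, this says that the vertex `g⁻¹ • x₀`, with `x₀` the
standard vertex, lies in the half-tree cut off by the `n`-th edge of the standard apartment. The
minima are avoided by the quantifiers over rows; as `det g = 1`, the valuations in a column of `g` are
not both `⊤`, so that this value causes no degenerate case. -/
def InHalfTree (n : ℤ) (g : SL(2, A)) : Prop :=
  ∃ i, ∀ j, v (g i 0) + n ≤ v (g j 1)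

/-- All entries of `p` have valuation at least `-K`. Multiplication by `p` then moves the vertices of
the tree by an amount bounded in terms of `K`. -/
def EntriesBounded (K : ℤ) (p : SL(2, A)) : Prop :=
  ∀ i j, ((-K : ℤ) : WithTop ℤ) ≤ v (p i j)

variable {v}

theorem EntriesBounded.mono {K L : ℤ} {p : SL(2, A)} (h : EntriesBounded v K p) (hKL : K ≤ L) :
    EntriesBounded v L p := fun i j ↦
  le_trans (WithTop.coe_le_coe.2 (by omega)) (h i j)

theorem EntriesBounded.inv {K : ℤ} {p : SL(2, A)} (h : EntriesBounded v K p) :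
    EntriesBounded v K p⁻¹ := by
  intro i j
  rw [SL2_inv_expl]
  fin_cases i <;> fin_cases j <;> simpa [AddValuation.map_neg] using h _ _

variable (v) in
theorem exists_entriesBounded (p : SL(2, A)) : ∃ K, EntriesBounded v K p := by
  obtain ⟨x, hx⟩ := Finite.exists_min fun x : Fin 2 × Fin 2 ↦ v (p x.1 x.2)
  induction h : v (p x.1 x.2) using WithTop.recTopCoe with
  | top => exact ⟨0, fun i j ↦ le_trans (by simp [h]) (hx (i, j))⟩
  | coe a => exact ⟨-a, fun i j ↦ le_trans (by simp [h]) (hx (i, j))⟩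

/-- The least valuation of an entry of the first column, a Busemann function on the tree, grows by at
most `K` under multiplication by `p`. -/
theorem EntriesBounded.exists_le {K : ℤ} {p : SL(2, A)} (hp : EntriesBounded v K p)
    {g : SL(2, A)} {m : ℤ} {i : Fin 2} (hm : v (g i 0) ≤ m) :
    ∃ j, v ((p * g) j 0) ≤ (m + K : ℤ) := by
  by_contra! h
  have key : ∀ j, (m : WithTop ℤ) < v (p⁻¹ i j * (p * g) j 0) := by
    intro j
    have hj := h j
    have hp' := hp.inv i j
    rw [AddValuation.map_mul]
    generalize v (p⁻¹ i j) = y at hp' ⊢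
    generalize v ((p * g) j 0) = z at hj ⊢
    induction y using WithTop.recTopCoe with
    | top => simp
    | coe a =>
      induction z using WithTop.recTopCoe with
      | top => simp
      | coe b =>
        norm_cast at *
        omega
  have hsum : g i 0 = p⁻¹ i 0 * (p * g) 0 0 + p⁻¹ i 1 * (p * g) 1 0 := by
    conv_lhs => rw [← inv_mul_cancel_left p g]
    simp only [coe_mul (p⁻¹), Matrix.mul_apply, Fin.sum_univ_two]
  have := lt_of_lt_of_le (lt_min (key 0) (key 1)) (v.map_add _ _)
  rw [← hsum] at this
  exact absurd hm (not_le.2 this)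

/-- A vertex that is deep on the far side of an edge, as measured by the first column of `g`, stays
there under a bounded move. The reason is that `(p * g) j 1 * g i 0 - (p * g) j 0 * g i 1` is, up to
sign, an entry of `p`, so that the ratio of the two columns hardly changes. -/
theorem InHalfTree.mul {K : ℤ} {p : SL(2, A)} (hp : EntriesBounded v K p) {g : SL(2, A)}
    {n m : ℤ} {i : Fin 2} (hm : v (g i 0) ≤ m) (h : n + 2 * K + 2 * m ≤ 0)
    (hg : InHalfTree v n g) : InHalfTree v n (p * g) := by
  obtain ⟨i₀, hi₀⟩ := Finite.exists_min fun i ↦ v (g i 0)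
  obtain ⟨j₀, hj₀⟩ := Finite.exists_min fun j ↦ v ((p * g) j 0)
  obtain ⟨c, hc⟩ := WithTop.ne_top_iff_exists.1
    (((hi₀ i).trans hm).trans_lt (WithTop.coe_lt_top m)).ne
  have hcm : c ≤ m := by
    rw [← WithTop.coe_le_coe, hc]
    exact (hi₀ i).trans hm
  obtain ⟨j₁, hj₁⟩ := hp.exists_le hc.ge
  obtain ⟨d, hd⟩ := WithTop.ne_top_iff_exists.1
    (((hj₀ j₁).trans hj₁).trans_lt (WithTop.coe_lt_top _)).ne
  have hdc : d ≤ c + K := by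
    rw [← WithTop.coe_le_coe, hd]
    exact (hj₀ j₁).trans hj₁
  refine ⟨j₀, fun j ↦ ?_⟩
  obtain ⟨i₁, hi₁⟩ := hg
  have hcol : ((c + n : ℤ) : WithTop ℤ) ≤ v (g i₀ 1) := by
    refine le_trans ?_ (hi₁ i₀)
    rw [WithTop.coe_add, hc]
    gcongr
    exact hi₀ i₁
  -- By `det g = 1`, the error `e` is `p j 1` or `-p j 0`, according to the row `i₀`.
  have hdet : ∃ e, ((-K : ℤ) : WithTop ℤ) ≤ v e ∧
      (p * g) j 1 * g i₀ 0 = (p * g) j 0 * g i₀ 1 + e := by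
    have hg1 := g.det_coe
    rw [Matrix.det_fin_two] at hg1
    have hp0 := hp j 0
    have hp1 := hp j 1
    simp only [coe_mul, Matrix.mul_apply, Fin.sum_univ_two]
    fin_cases i₀
    · refine ⟨p j 1, hp1, ?_⟩
      simp only [Fin.zero_eta]
      linear_combination p j 1 * hg1
    · refine ⟨- p j 0, by rwa [AddValuation.map_neg], ?_⟩
      simp only [Fin.mk_one]
      linear_combination (- p j 0) * hg1
  obtain ⟨e, he, hdet⟩ := hdet
  have hdj := hj₀ j
  rw [← hd] at hdj ⊢
  have hle : ((d + c + n : ℤ) : WithTop ℤ) ≤ v ((p * g) j 1 * g i₀ 0) := by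
    rw [hdet]
    refine le_trans (le_min ?_ ?_) (v.map_add _ _)
    · rw [AddValuation.map_mul, add_assoc, WithTop.coe_add]
      exact add_le_add hdj hcol
    · exact le_trans (WithTop.coe_le_coe.2 (by omega)) he
  rw [AddValuation.map_mul, ← hc] at hle
  generalize v ((p * g) j 1) = y at hle ⊢
  induction y using WithTop.recTopCoe with
  | top => simp
  | coe b =>
    norm_cast at *
    omega

/-- A bounded move can cross the `n`-th edge only close to the height of that edge: if the first column
of `g` has an entry of small valuation, then multiplication by `p` preserves the half-tree. -/
theorem inHalfTree_mul_iff {K : ℤ} {p : SL(2, A)} (hp : EntriesBounded v K p) {g : SL(2, A)}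
    {n m : ℤ} {i : Fin 2} (hm : v (g i 0) ≤ m) (hK : 0 ≤ K) (h : n + 4 * K + 2 * m ≤ 0) :
    InHalfTree v n (p * g) ↔ InHalfTree v n g := by
  refine ⟨fun hg ↦ ?_, InHalfTree.mul hp hm (by omega)⟩
  obtain ⟨j, hj⟩ := hp.exists_le hm
  simpa using hg.mul hp.inv hj (by omega)

end HalfTree

/-! ### The commutator loops -/

section Laurent

open LaurentPolynomial

variable {R : Type*} [CommRing R]

variable (R) in
/-- The diagonal matrix with entries `T` and `T⁻¹`. -/
def torusT : SL(2, R[T;T⁻¹]) :=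
  ⟨!![T 1, 0; 0, T (-1)], by simp [Matrix.det_fin_two_of, -T_mul, ← T_add]⟩

/-- The product of the diagonal matrix with entries `T ^ (-i)` and `T ^ i` and the unipotent matrix
with upper right entry `x`. The inverses of these matrices with `x` fixed move the base point of the
product of the two trees along a line in one flat; `flatPoint 0 x` is the unipotent matrix itself. -/
def flatPoint (i : ℤ) (x : R[T;T⁻¹]) : SL(2, R[T;T⁻¹]) :=
  ⟨!![T (-i), T (-i) * x; 0, T i], by simp [Matrix.det_fin_two_of, -T_mul, ← T_add]⟩

variable (R) in
theorem coe_torusT : (torusT R : Matrix (Fin 2) (Fin 2) R[T;T⁻¹]) = !![T 1, 0; 0, T (-1)] := rfl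

theorem coe_flatPoint (i : ℤ) (x : R[T;T⁻¹]) :
    (flatPoint i x : Matrix (Fin 2) (Fin 2) R[T;T⁻¹]) = !![T (-i), T (-i) * x; 0, T i] := rfl

theorem flatPoint_zero_zero : flatPoint 0 (0 : R[T;T⁻¹]) = 1 := by
  apply Subtype.ext
  rw [coe_flatPoint, coe_one, Matrix.one_fin_two]
  simp

theorem flatPoint_zero_mul (i : ℤ) (x y : R[T;T⁻¹]) :
    flatPoint 0 x * flatPoint i y = flatPoint i (y + T (2 * i) * x) := by
  have h : T (-i) * (y + T (2 * i) * x) = T (-i) * y + x * T i := by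
    rw [mul_add, ← mul_assoc, ← T_add, mul_comm x]
    congr 3
    ring
  apply Subtype.ext
  rw [coe_mul, coe_flatPoint, coe_flatPoint, coe_flatPoint, Matrix.mul_fin_two, h]
  simp only [neg_zero, T_zero, one_mul, mul_zero, add_zero, zero_mul, zero_add]

theorem torusT_mul_flatPoint (i : ℤ) (x : R[T;T⁻¹]) :
    torusT R * flatPoint i x = flatPoint (i - 1) x := by
  have h₁ : 1 + -i = -(i - 1) := by ring
  have h₂ : -1 + i = i - 1 := by ring
  apply Subtype.ext
  rw [coe_mul, coe_torusT, coe_flatPoint, coe_flatPoint, Matrix.mul_fin_two]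
  simp only [mul_zero, add_zero, zero_mul, zero_add, ← mul_assoc, ← T_add, h₁, h₂]

theorem torusT_pow_mul_flatPoint (k : ℕ) (i : ℤ) (x : R[T;T⁻¹]) :
    torusT R ^ k * flatPoint i x = flatPoint (i - k) x := by
  induction k with
  | zero => simp
  | succ k ih =>
    rw [pow_succ', mul_assoc, ih, torusT_mul_flatPoint]
    congr 1
    push_cast
    ring

/-- Half-trees along the lines `flatPoint i x`; the order at `T = 0` has `ε = 1` and the order at
`T = ∞` has `ε = -1`. -/
theorem inHalfTree_flatPoint_iff {v : AddValuation R[T;T⁻¹] (WithTop ℤ)} {ε : ℤ}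
    (hv : ∀ n, v (T n) = (ε * n : ℤ)) (n i : ℤ) (x : R[T;T⁻¹]) :
    InHalfTree v n (flatPoint i x) ↔ (n : WithTop ℤ) ≤ v x ∧ n ≤ 2 * (ε * i) := by
  have h₀ : ∀ y : WithTop ℤ, ((ε * -i : ℤ) : WithTop ℤ) + n ≤ y + (ε * -i : ℤ) ↔ n ≤ y :=
    fun y ↦ by
      induction y using WithTop.recTopCoe with
      | top => simp
      | coe b =>
        norm_cast
        omega
  have h₁ : ((ε * -i : ℤ) : WithTop ℤ) + n ≤ (ε * i : ℤ) ↔ n ≤ 2 * (ε * i) := by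
    rw [← WithTop.coe_add, WithTop.coe_le_coe, mul_neg]
    omega
  simp [InHalfTree, flatPoint, Fin.exists_fin_two, Fin.forall_fin_two, hv, h₀, h₁,
    -WithTop.coe_mul, -mul_neg]

variable [IsDomain R]

open scoped Classical in
variable (R) in
/-- The indicator function of a fixed half-tree for the place `T = 0`. -/
def sideAtZero (g : SL(2, R[T;T⁻¹])) : ℤ := if InHalfTree (orderAtZero R) 1 g then 1 else 0

open scoped Classical in
variable (R) in
/-- The indicator function of a half-tree for the place `T = ∞`; its bounding edge goes off into the
cusp as `k` grows. -/
def sideAtInfty (k : ℕ) (g : SL(2, R[T;T⁻¹])) : ℤ :=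
  if InHalfTree (orderAtInfty R) (1 - 2 * k) g then 1 else 0

variable (R) in
/-- The permutations which record winding numbers around the square spanned by the bounding edges of
the half-trees `sideAtZero` and `sideAtInfty k`. -/
abbrev areaAction (k : ℕ) : SL(2, R[T;T⁻¹]) → Equiv.Perm (SL(2, R[T;T⁻¹]) × ℤ) :=
  areaPerm (sideAtZero R) (sideAtInfty R k)

/-- For large `k`, a given triangle has no translate that winds around the square of `areaAction k`.
A side that crosses the edge at `T = 0` forces the first column of `g` to have order bounded below at
`T = 0`, hence order bounded above at `T = ∞`, and the edge there is out of reach. -/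
theorem eventually_areaAction_mul (a b : SL(2, R[T;T⁻¹])) :
    ∀ᶠ k in atTop, areaAction R k (a * b) = areaAction R k a * areaAction R k b := by
  classical
  obtain ⟨K₁, h₁⟩ := exists_entriesBounded (orderAtZero R) b
  obtain ⟨K₂, h₂⟩ := exists_entriesBounded (orderAtInfty R) b
  obtain ⟨K₃, h₃⟩ := exists_entriesBounded (orderAtInfty R) a
  obtain ⟨K, hK, hK₁, hK₂, hK₃⟩ : ∃ K : ℤ, 0 ≤ K ∧ K₁ ≤ K ∧ K₂ ≤ K ∧ K₃ ≤ K :=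
    ⟨max (max 0 K₁) (max K₂ K₃), by simp⟩
  -- The near case below has `d ≤ -c ≤ 2 * K`, and needs `2 * (d + K) + 4 * K + 1 ≤ 2 * k`.
  filter_upwards [eventually_ge_atTop (5 * K + 3).toNat] with k hk
  refine areaPerm_mul fun g ↦ ?_
  obtain ⟨i, hi⟩ : ∃ i, g i 0 ≠ 0 := by
    by_contra! h
    have hdet := g.det_coe
    rw [Matrix.det_fin_two, h 0, h 1] at hdet
    simp at hdet
  obtain ⟨c, d, hc, hd, hcd⟩ := exists_orders_eq_of_ne_zero hi
  rcases le_or_gt (1 + 4 * K + 2 * c) 0 with hfar | hnear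
  · left
    exact if_congr (inHalfTree_mul_iff (h₁.mono hK₁) hc.le hK hfar) rfl rfl
  · right
    obtain ⟨j, hj⟩ := (h₂.mono hK₂).exists_le hd.le
    exact if_congr (inHalfTree_mul_iff (h₃.mono hK₃) hj hK (by omega)) rfl rfl

theorem sideAtZero_flatPoint (i : ℤ) (x : R[T;T⁻¹]) [Decidable (1 ≤ orderAtZero R x ∧ 1 ≤ i)] :
    sideAtZero R (flatPoint i x) = if 1 ≤ orderAtZero R x ∧ 1 ≤ i then 1 else 0 := by
  have h := inHalfTree_flatPoint_iff (v := orderAtZero R) (ε := 1)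
    (fun n ↦ by rw [orderAtZero_T, one_mul]) 1 i x
  have h' : (1 : ℤ) ≤ 2 * (1 * i) ↔ 1 ≤ i := by omega
  rw [h', WithTop.coe_one] at h
  simp only [sideAtZero, h]

theorem sideAtInfty_flatPoint (k : ℕ) (i : ℤ) (x : R[T;T⁻¹])
    [Decidable (((1 - 2 * k : ℤ) : WithTop ℤ) ≤ orderAtInfty R x ∧ i < k)] :
    sideAtInfty R k (flatPoint i x) =
      if ((1 - 2 * k : ℤ) : WithTop ℤ) ≤ orderAtInfty R x ∧ i < k then 1 else 0 := by
  have h := inHalfTree_flatPoint_iff (v := orderAtInfty R) (ε := -1)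
    (fun n ↦ by rw [orderAtInfty_T, neg_one_mul]) (1 - 2 * k) i x
  have h' : (1 - 2 * k : ℤ) ≤ 2 * (-1 * i) ↔ i < k := by omega
  rw [h'] at h
  simp only [sideAtInfty, h]

theorem areaAction_flatPoint_zero (k : ℕ) (i : ℤ) (x y : R[T;T⁻¹]) (z : ℤ) :
    areaAction R k (flatPoint 0 x) (flatPoint i y, z) =
      (flatPoint i (y + T (2 * i) * x), z + sideAtZero R (flatPoint i y) *
        (sideAtInfty R k (flatPoint i (y + T (2 * i) * x)) -
          sideAtInfty R k (flatPoint i y))) := by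
  rw [areaPerm_apply, flatPoint_zero_mul]

theorem areaAction_torusT_pow (k : ℕ) (x : R[T;T⁻¹]) (z : ℤ) :
    (areaAction R k (torusT R) ^ k) (flatPoint k x, z) =
      (flatPoint 0 x, z + ∑ i ∈ Finset.range k, sideAtZero R (flatPoint (k - i) x) *
        (sideAtInfty R k (flatPoint (k - (i + 1 : ℕ)) x) -
          sideAtInfty R k (flatPoint (k - i) x))) := by
  simp only [areaPerm_pow_apply, torusT_pow_mul_flatPoint, sub_self]

/-- The closed path that spells out the commutator of the unipotent matrices with upper right entries
`1` and `T ^ (2 * k)`, the latter as a conjugate by `torusT ^ k`, runs along four lines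
`flatPoint i x` with `0 ≤ i ≤ k` and `x = 0, 1, T ^ (2 * k), 1 + T ^ (2 * k)`. The line `x = 0`
is the only one along which both indicator functions jump, so the winding number is not zero. -/
theorem areaAction_not_commute {k : ℕ} (hk : 1 ≤ k) :
    ¬ Commute (areaAction R k (flatPoint 0 1))
      (areaAction R k (torusT R) ^ k * areaAction R k (flatPoint 0 1) *
        (areaAction R k (torusT R) ^ k)⁻¹) := by
  classical
  have hzero_one : ∀ i, sideAtZero R (flatPoint i 1) = 0 := fun i ↦ by
    rw [sideAtZero_flatPoint, if_neg]
    simp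
  have hinfty_T : ∀ i, sideAtInfty R k (flatPoint i (T (2 * k))) = 0 := fun i ↦ by
    rw [sideAtInfty_flatPoint, if_neg]
    rw [orderAtInfty_T, WithTop.coe_le_coe]
    omega
  have hinfty_one_add_T : ∀ i, sideAtInfty R k (flatPoint i (1 + T (2 * k))) = 0 := fun i ↦ by
    rw [sideAtInfty_flatPoint, if_neg]
    rintro ⟨h, -⟩
    have h₁ : ((1 - 2 * k : ℤ) : WithTop ℤ) ≤ orderAtInfty R 1 := by
      rw [AddValuation.map_one, ← WithTop.coe_zero, WithTop.coe_le_coe]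
      omega
    have h₂ := (le_min h h₁).trans ((orderAtInfty R).map_sub _ _)
    rw [add_sub_cancel_left, orderAtInfty_T, WithTop.coe_le_coe] at h₂
    omega
  have hzero_start : ∀ x : R[T;T⁻¹], sideAtZero R (flatPoint 0 x) = 0 := fun x ↦ by
    rw [sideAtZero_flatPoint, if_neg]
    simp
  have hinfty_end : ∀ x : R[T;T⁻¹], sideAtInfty R k (flatPoint k x) = 0 := fun x ↦ by
    rw [sideAtInfty_flatPoint, if_neg]
    simp
  have hinfty_start : sideAtInfty R k (flatPoint 0 0) = 1 := by
    rw [sideAtInfty_flatPoint, if_pos]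
    simpa using Nat.pos_of_ne_zero (by omega)
  have hzero_line : ∀ i ∈ Finset.range k,
      sideAtZero R (flatPoint (k - i) 0) = 1 := fun i hi ↦ by
    rw [sideAtZero_flatPoint, if_pos]
    rw [Finset.mem_range] at hi
    simp
    omega
  have hpath : (areaAction R k (torusT R) ^ k) (flatPoint k 0, 0) = (flatPoint 0 0, 1) := by
    rw [areaAction_torusT_pow, Finset.sum_congr rfl fun i hi ↦ by rw [hzero_line i hi, one_mul],
      Finset.sum_range_sub fun i : ℕ ↦ sideAtInfty R k (flatPoint (k - i) 0)]
    simp [hinfty_start, hinfty_end]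
  have hpath_one : (areaAction R k (torusT R) ^ k) (flatPoint k 1, 1) = (flatPoint 0 1, 1) := by
    simp [areaAction_torusT_pow, hzero_one]
  intro hcomm
  -- The common end point is reached from `(flatPoint 0 0, 1)` with second coordinate `0` along one
  -- side of the commutator relation and `1` along the other.
  have h := DFunLike.congr_fun hcomm.eq (flatPoint 0 0, 1)
  have h' : (areaAction R k (torusT R) ^ k)⁻¹ (flatPoint 0 0, 1) = (flatPoint k 0, 0) := by
    rw [← hpath, ← Equiv.Perm.mul_apply, inv_mul_cancel, Equiv.Perm.one_apply]
  have h'' : (areaAction R k (torusT R) ^ k)⁻¹ (flatPoint 0 1, 1) = (flatPoint k 1, 1) := by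
    rw [← hpath_one, ← Equiv.Perm.mul_apply, inv_mul_cancel, Equiv.Perm.one_apply]
  simp only [Equiv.Perm.mul_apply, h', areaAction_flatPoint_zero] at h
  simp [h'', areaAction_flatPoint_zero, areaAction_torusT_pow, hinfty_end, hinfty_T,
    hinfty_one_add_T, hzero_start, hzero_one] at h

/-- Over any integral domain, `SL₂` of the Laurent polynomial ring is not finitely presented. -/
theorem not_isFinitelyPresented_laurentPolynomial :
    ¬ Group.IsFinitelyPresented SL(2, R[T;T⁻¹]) := by
  intro hfp
  obtain ⟨θ, hθ⟩ := Group.IsFinitelyPresented.exists_monoidHom_eventually_eq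
    (areaAction R) eventually_areaAction_mul
  obtain ⟨k, hu, ht, hk⟩ :=
    ((hθ (flatPoint 0 1)).and ((hθ (torusT R)).and (eventually_ge_atTop 1))).exists
  apply areaAction_not_commute (R := R) hk
  have hconj : torusT R ^ k * flatPoint 0 1 * (torusT R ^ k)⁻¹ = flatPoint 0 (T (2 * k)) := by
    have h₁ : flatPoint (k : ℤ) (T (2 * k)) = flatPoint 0 1 * flatPoint k (0 : R[T;T⁻¹]) := by
      simp [flatPoint_zero_mul]
    have h₂ : torusT R ^ k * flatPoint k 0 = 1 := by
      simp [torusT_pow_mul_flatPoint, flatPoint_zero_zero]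
    rw [inv_eq_of_mul_eq_one_right h₂, mul_assoc, ← h₁, torusT_pow_mul_flatPoint, sub_self]
  have hcomm : Commute (flatPoint 0 1) (torusT R ^ k * flatPoint 0 1 * (torusT R ^ k)⁻¹) := by
    rw [hconj]
    simp [commute_iff_eq, flatPoint_zero_mul, add_comm]
  have := hcomm.map (θ k)
  simpa only [map_mul, map_inv, map_pow, hu, ht] using this

end Laurent

end Matrix.SpecialLinearGroup

end

theorem corollary3p2 :
    ¬ Group.IsFinitelyPresented
      (Matrix.SpecialLinearGroup (Fin 2) (LaurentPolynomial ℤ)) :=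
  Matrix.SpecialLinearGroup.not_isFinitelyPresented_laurentPolynomial
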